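/- For every constant $p\in(0,1)$ there is a constant $c>0$, depending only on $p$, such that the following holds for all integers $n\ge 1$, $d\ge 2$, $m\ge 0$ and all real $\epsilon$ with $0<\epsilon<p$. Suppose that a quantum algorithm, given $m$ copies of an unknown state $\rho=\rho_1\otimes\cdots\otimes\rho_n$, where each $\rho_i$ is a pure state on $\mathbb C^d$, outputs a description of a state $\hat\rho=\hat\rho_1\otimes\cdots\otimes\hat\rho_n$, where each $\hat\rho_i$ is a pure state on $\mathbb C^d$, such that, for every such $\rho$, $$\Pr\big[F(\rho,\hat\rho)\ge 1-\epsilon\big]\ \ge\ p .$$ Then $$m\ \ge\ c\,\frac{nd}{\epsilon}.$$ Here $F(\rho,\sigma)=\big(\operatorname{Tr}\sqrt{\sqrt\rho\,\sigma\sqrt\rho}\,\big)^2$ is the fidelity. A quantum algorithm is any measurement of all $m$ copies jointly: a positive operator-valued measure $E$ on the (Borel) space of $n$-tuples of pure states on $\mathbb C^d$, acting on $\big((\mathbb C^d)^{\otimes n}\big)^{\otimes m}$, with $\Pr[\hat\rho\in S]=\operatorname{Tr}\big(E(S)\,\rho^{\otimes m}\big)$. No bound on running time is assumed. -/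

import Mathlib

open scoped ComplexOrder MatrixOrder

namespace QLearn

noncomputable section

/-- A density matrix `ρ` on `ℂᵈ` is pure if `ρ = |ψ⟩⟨ψ|` for some unit vector `ψ`. -/
def IsPure {d : ℕ} (ρ : Matrix (Fin d) (Fin d) ℂ) : Prop :=
  ∃ ψ : Fin d → ℂ, ∑ i, ‖ψ i‖ ^ 2 = 1 ∧ ρ = Matrix.vecMulVec ψ (star ψ)

/-- The pure states of a `d`-dimensional system, as density matrices. -/
def PureState (d : ℕ) : Type := {ρ : Matrix (Fin d) (Fin d) ℂ // IsPure ρ}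

instance (d : ℕ) : TopologicalSpace (PureState d) :=
  inferInstanceAs (TopologicalSpace {ρ : Matrix (Fin d) (Fin d) ℂ // IsPure ρ})

instance (d : ℕ) : MeasurableSpace (PureState d) := borel (PureState d)

instance (d : ℕ) : BorelSpace (PureState d) := ⟨rfl⟩

/-- The tensor product `A₁ ⊗ … ⊗ A_k` of square matrices of the same size (iterated Kronecker
product). The product basis of `(ℂ^ι)^{⊗ k}` is indexed by `Fin k → ι`. -/
def tensor {k : ℕ} {ι : Type*} (A : Fin k → Matrix ι ι ℂ) :
    Matrix (Fin k → ι) (Fin k → ι) ℂ :=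
  Matrix.of fun x y => ∏ i, A i (x i) (y i)

/-- The product state `ρ₁ ⊗ … ⊗ ρₙ` on `n` sites of dimension `d`. -/
def productState {n d : ℕ} (ρ : Fin n → PureState d) :
    Matrix (Fin n → Fin d) (Fin n → Fin d) ℂ :=
  tensor fun i => (ρ i).1

/-- The state `ρ^{⊗ m}` of `m` copies of a state `ρ`. -/
def copies {ι : Type*} (m : ℕ) (ρ : Matrix ι ι ℂ) : Matrix (Fin m → ι) (Fin m → ι) ℂ :=
  tensor fun _ => ρ

/-- The fidelity `F(ρ, σ) = (Tr √(√ρ σ √ρ))²` of two density matrices. -/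
def fidelity {ι : Type*} [Fintype ι] [DecidableEq ι] (ρ σ : Matrix ι ι ℂ) : ℝ :=
  (Matrix.trace (CFC.sqrt (CFC.sqrt ρ * σ * CFC.sqrt ρ))).re ^ 2

/-- A positive operator-valued measure (POVM) on a finite-dimensional system whose basis is
indexed by `ι`, with outcomes in the measurable space `Ω`: a `σ`-additive map from the measurable
subsets of `Ω` to positive semidefinite matrices, of total mass the identity. -/
structure POVM (Ω : Type*) [MeasurableSpace Ω] (ι : Type*) [Fintype ι] [DecidableEq ι] where
  /-- the underlying matrix-valued measure -/
  effect : MeasureTheory.VectorMeasure Ω (Matrix ι ι ℂ)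
  posSemidef : ∀ S : Set Ω, (effect S).PosSemidef
  total : effect Set.univ = 1

/-- Born's rule: the probability that measuring the state `ρ` gives an outcome in `S`. -/
def POVM.prob {Ω : Type*} [MeasurableSpace Ω] {ι : Type*} [Fintype ι] [DecidableEq ι]
    (M : POVM Ω ι) (ρ : Matrix ι ι ℂ) (S : Set Ω) : ℝ :=
  (Matrix.trace (M.effect S * ρ)).re

/-- A quantum algorithm that gets `m` copies of a state of `n` sites of dimension `d` and outputs
(the tensor factors of) a pure product state. Whatever the algorithm does (collective or adaptive
measurements, ancillas, classical randomness and post-processing), the law of its output as a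
function of the input is given by a POVM on all the `m` copies, and every POVM is allowed. -/
abbrev ProductLearner (n d m : ℕ) : Type :=
  POVM (Fin n → PureState d) (Fin m → Fin n → Fin d)

/-- The algorithm outputs, on `m` copies of `ρ₁ ⊗ … ⊗ ρₙ`, a product state of fidelity at least
`1 - ε` with it with probability at least `p`, for every pure product state. -/
def ProductLearner.Learns {n d m : ℕ} (A : ProductLearner n d m) (ε p : ℝ) : Prop :=
  ∀ ρ : Fin n → PureState d,
    p ≤ POVM.prob A (copies m (productState ρ))
      {σ | 1 - ε ≤ fidelity (productState ρ) (productState σ)}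

end

end QLearn

namespace QLearn

open MeasureTheory
open scoped ENNReal

/-! Write `d = D + 1`. The proof is a Bayesian volume argument: draw each site at random, as a
normalised complex Gaussian vector, and bound the average success probability. The vector of `m`
copies of a pure product state lies in the tensor product over the sites of the symmetric powers
`Sym^m(ℂᵈ)`, a space of dimension `C(m+D, m)^n` with orthogonal projection `W`. For every effect
`E`, the Born probability is at most `Re tr(E W)`, which no longer depends on the input and defines
a measure on outputs of mass at most that dimension. Exchanging the two integrals gives `p ≤ C(m+D,
m)^n * b`, where `b` bounds the probability that a random product state has fidelity at least `1 -
ε` with a fixed one (`ProductLearner.Learns.le_of_gaussProd_le`). Two values of `b` are used. A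
Chernoff bound (`gaussProd_le_exp`) yields `m + D ≥ a n D / ε`, with `a` depending only on `p`. The
cruder `b = ε^(D n)` (`gaussProd_le_pow`) yields `D ≤ β m`, with `β` depending only on `p`, so that
`D` can be absorbed into `m`. -/

/-! ### Product integrals and the complex Gaussian -/

/-- Tonelli's theorem for a product of functions of the single coordinates. -/
theorem lintegral_pi_prod {n : ℕ} {E : Type*} [MeasurableSpace E] (μ : Measure E) [SigmaFinite μ]
    (f : Fin n → E → ℝ≥0∞) (hf : ∀ i, Measurable (f i)) :
    ∫⁻ x, ∏ i, f i (x i) ∂(Measure.pi fun _ => μ) = ∏ i, ∫⁻ x, f i x ∂μ := by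
  induction n with
  | zero => simp
  | succ n ih =>
    have h := (measurePreserving_piFinSuccAbove (fun _ : Fin (n + 1) => μ) 0).symm
    rw [← h.lintegral_comp_emb (MeasurableEquiv.measurableEmbedding _)]
    simp_rw [MeasurableEquiv.piFinSuccAbove_symm_apply, Fin.insertNthEquiv,
      Fin.prod_univ_succ]
    simp only [Equiv.coe_fn_mk, Fin.insertNth_zero, Fin.cons_zero, Fin.cons_succ, cast_eq]
    rw [lintegral_prod_mul (f := f 0) (g := fun y : Fin n → E => ∏ i, f i.succ (y i))
      (hf 0).aemeasurable
      (Finset.measurable_fun_prod _ fun i _ => (hf _).comp (measurable_pi_apply i)).aemeasurable]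
    rw [ih (fun i => f i.succ) fun i => hf _]

theorem pi_withDensity {n : ℕ} {E : Type*} [MeasurableSpace E] (μ : Measure E) [SigmaFinite μ]
    (f : E → ℝ≥0∞) (hf : Measurable f) [SigmaFinite (μ.withDensity f)] :
    (Measure.pi fun _ : Fin n => μ.withDensity f) =
      (Measure.pi fun _ : Fin n => μ).withDensity fun x => ∏ i, f (x i) := by
  refine Measure.pi_eq fun s hs => ?_
  rw [withDensity_apply _ (MeasurableSet.univ_pi hs), ← lintegral_indicator (MeasurableSet.univ_pi hs)]
  simp_rw [withDensity_apply _ (hs _), ← lintegral_indicator (hs _)]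
  rw [← lintegral_pi_prod μ (fun i => (s i).indicator f) fun i => hf.indicator (hs i)]
  refine lintegral_congr fun x => ?_
  by_cases hx : x ∈ Set.univ.pi s
  · rw [Set.indicator_of_mem hx]
    exact Finset.prod_congr rfl fun i _ => (Set.indicator_of_mem (hx i trivial) _).symm
  · rw [Set.indicator_of_notMem hx]
    simp only [Set.mem_pi, Set.mem_univ, forall_const, not_forall] at hx
    obtain ⟨i, hi⟩ := hx
    exact (Finset.prod_eq_zero (Finset.mem_univ i) (Set.indicator_of_notMem hi _)).symm

/-- The density of the standard complex Gaussian. -/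
noncomputable def gaussDensity (z : ℂ) : ℝ≥0∞ := ENNReal.ofReal (Real.exp (-(Real.pi * ‖z‖ ^ 2)))

theorem measurable_gaussDensity : Measurable gaussDensity := by
  unfold gaussDensity; fun_prop

/-- The standard complex Gaussian measure, of density `exp (-π |z|²)`. -/
noncomputable def gaussC : Measure ℂ := volume.withDensity gaussDensity

theorem lintegral_Ioi_gauss {a : ℝ} (ha : 0 < a) {t : ℝ} :
    ∫⁻ r in Set.Ioi t, ENNReal.ofReal (2 * a * r * Real.exp (-(a * r ^ 2)))
      ∂(volume.restrict (Set.Ioi 0)) = ENNReal.ofReal (Real.exp (-(a * (max t 0) ^ 2))) := by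
  rw [Measure.restrict_restrict measurableSet_Ioi, Set.Ioi_inter_Ioi]
  have hd : ∀ x ∈ Set.Ici (t ⊔ 0), HasDerivAt (fun r : ℝ => -Real.exp (-(a * r ^ 2)))
      (2 * a * x * Real.exp (-(a * x ^ 2))) x := by
    intro x _
    have h1 : HasDerivAt (fun r : ℝ => -(a * r ^ 2)) (-(a * (2 * x))) x := by
      convert! ((hasDerivAt_pow 2 x).const_mul a).neg using 1
      simp
    convert! h1.exp.neg using 1
    ring
  have hlim : Filter.Tendsto (fun r : ℝ => -Real.exp (-(a * r ^ 2))) Filter.atTop (nhds (-0)) := by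
    refine (Real.tendsto_exp_neg_atTop_nhds_zero.comp ?_).neg
    exact (Filter.tendsto_pow_atTop two_ne_zero).const_mul_atTop ha
  have hnn : ∀ x ∈ Set.Ioi (t ⊔ 0), 0 ≤ 2 * a * x * Real.exp (-(a * x ^ 2)) := by
    intro x hx
    have : 0 < x := (le_max_right _ _).trans_lt hx
    positivity
  rw [← ofReal_integral_eq_lintegral_ofReal
    (integrableOn_Ioi_deriv_of_nonneg' hd hnn hlim)
    ((ae_restrict_mem measurableSet_Ioi).mono hnn),
    integral_Ioi_of_hasDerivAt_of_nonneg' hd hnn hlim]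
  simp

theorem lintegral_gauss_tail {a : ℝ} (ha : 0 < a) (t : ℝ) :
    ∫⁻ z in {z : ℂ | t < ‖z‖}, ENNReal.ofReal (Real.exp (-(a * ‖z‖ ^ 2))) =
      ENNReal.ofReal (Real.pi / a * Real.exp (-(a * (max t 0) ^ 2))) := by
  have hm : MeasurableSet {z : ℂ | t < ‖z‖} := measurableSet_lt measurable_const measurable_norm
  rw [← lintegral_indicator hm, ← Complex.lintegral_comp_polarCoord_symm]
  have h1 : ∀ p ∈ polarCoord.target, ENNReal.ofReal p.1 •
      ({z : ℂ | t < ‖z‖}.indicator (fun z : ℂ => ENNReal.ofReal (Real.exp (-(a * ‖z‖ ^ 2))))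
        (Complex.polarCoord.symm p)) =
      (Set.Ioi t).indicator (fun r => ENNReal.ofReal (2 * a * r * Real.exp (-(a * r ^ 2)))) p.1 *
        ENNReal.ofReal (1 / (2 * a)) := by
    rintro ⟨r, θ⟩ hp
    have hr : 0 < r := hp.1
    by_cases h : t < r
    · rw [Set.indicator_of_mem, Set.indicator_of_mem (by exact h)]
      · rw [Complex.norm_polarCoord_symm, abs_of_pos hr, smul_eq_mul,
          ← ENNReal.ofReal_mul hr.le, ← ENNReal.ofReal_mul (by positivity)]
        congr 1
        field_simp
      · simpa [Complex.norm_polarCoord_symm, abs_of_pos hr, -Complex.polarCoord_symm_apply] using h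
    · rw [Set.indicator_of_notMem, Set.indicator_of_notMem (by exact h)]
      · simp
      · simpa [Complex.norm_polarCoord_symm, abs_of_pos hr, -Complex.polarCoord_symm_apply] using h
  rw [setLIntegral_congr_fun (polarCoord.open_target.measurableSet) h1, polarCoord_target,
    Measure.volume_eq_prod, ← Measure.prod_restrict]
  have hmeas : Measurable fun r : ℝ => (Set.Ioi t).indicator
      (fun r => ENNReal.ofReal (2 * a * r * Real.exp (-(a * r ^ 2)))) r :=
    Measurable.indicator (by fun_prop) measurableSet_Ioi
  rw [lintegral_prod_mul (f := fun r : ℝ => (Set.Ioi t).indicator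
      (fun r => ENNReal.ofReal (2 * a * r * Real.exp (-(a * r ^ 2)))) r)
      (g := fun _ => ENNReal.ofReal (1 / (2 * a))) hmeas.aemeasurable (by fun_prop),
    lintegral_indicator measurableSet_Ioi, lintegral_Ioi_gauss ha]
  rw [lintegral_const, Measure.restrict_apply_univ, Real.volume_Ioo, ← ENNReal.ofReal_mul (by positivity),
    ← ENNReal.ofReal_mul (by positivity)]
  congr 1
  field_simp
  ring

theorem lintegral_gauss {a : ℝ} (ha : 0 < a) :
    ∫⁻ z : ℂ, ENNReal.ofReal (Real.exp (-(a * ‖z‖ ^ 2))) = ENNReal.ofReal (Real.pi / a) := by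
  -- A negative threshold makes the tail region the whole plane.
  have h := lintegral_gauss_tail ha (-1)
  have hu : {z : ℂ | -1 < ‖z‖} = Set.univ := by
    ext z; simpa using (neg_one_lt_zero.trans_le (norm_nonneg z))
  rw [hu, Measure.restrict_univ] at h
  simpa using h

instance : IsProbabilityMeasure gaussC := by
  refine ⟨?_⟩
  rw [gaussC, withDensity_apply _ MeasurableSet.univ, Measure.restrict_univ]
  have := lintegral_gauss Real.pi_pos
  rw [div_self Real.pi_ne_zero, ENNReal.ofReal_one] at this
  exact this

theorem gaussC_tail (t : ℝ) (ht : 0 ≤ t) :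
    gaussC {z : ℂ | t < ‖z‖} = ENNReal.ofReal (Real.exp (-(Real.pi * t ^ 2))) := by
  rw [gaussC, withDensity_apply _ (measurableSet_lt measurable_const measurable_norm)]
  have := lintegral_gauss_tail Real.pi_pos t
  rw [div_self Real.pi_ne_zero, one_mul, max_eq_left ht] at this
  exact this

/-- The closed tail is contained in the open tails at every `s < t`; let `s` tend to `t`. -/
theorem gaussC_tail_le (t : ℝ) (ht : 0 ≤ t) :
    gaussC {z : ℂ | t ≤ ‖z‖} ≤ ENNReal.ofReal (Real.exp (-(Real.pi * t ^ 2))) := by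
  rcases ht.eq_or_lt with rfl | ht
  · simp
  have hc : ContinuousWithinAt (fun s : ℝ => ENNReal.ofReal (Real.exp (-(Real.pi * s ^ 2))))
      (Set.Iio t) t := by
    refine Continuous.continuousWithinAt ?_
    exact ENNReal.continuous_ofReal.comp (by fun_prop)
  refine ge_of_tendsto hc.tendsto ?_
  filter_upwards [Ioo_mem_nhdsLT ht] with s hs
  rw [← gaussC_tail s hs.1.le]
  exact measure_mono fun z hz => hs.2.trans_le hz

theorem lintegral_gaussC_exp {a : ℝ} (ha : 0 ≤ a) :
    ∫⁻ z : ℂ, ENNReal.ofReal (Real.exp (-(a * (Real.pi * ‖z‖ ^ 2)))) ∂gaussC =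
      ENNReal.ofReal (1 / (1 + a)) := by
  rw [gaussC, lintegral_withDensity_eq_lintegral_mul _ measurable_gaussDensity (by fun_prop)]
  have h := lintegral_gauss (a := (1 + a) * Real.pi) (by positivity)
  rw [show Real.pi / ((1 + a) * Real.pi) = 1 / (1 + a) by field_simp] at h
  rw [← h]
  refine lintegral_congr fun z => ?_
  rw [Pi.mul_apply, gaussDensity, ← ENNReal.ofReal_mul (Real.exp_nonneg _), ← Real.exp_add]
  congr 2
  ring

/-! ### Gaussian vectors: unitary invariance and the measure of a cone -/

/-- The standard Gaussian measure on `ℂᵈ`. -/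
noncomputable def gaussVec (d : ℕ) : Measure (Fin d → ℂ) := Measure.pi fun _ => gaussC

instance (d : ℕ) : IsProbabilityMeasure (gaussVec d) := by
  unfold gaussVec; infer_instance

theorem gaussVec_eq (d : ℕ) : gaussVec d = (volume : Measure (Fin d → ℂ)).withDensity
    fun x => ENNReal.ofReal (Real.exp (-(Real.pi * ∑ i, ‖x i‖ ^ 2))) := by
  have : SigmaFinite ((volume : Measure ℂ).withDensity gaussDensity) := by
    change SigmaFinite gaussC; infer_instance
  unfold gaussVec gaussC
  rw [pi_withDensity volume gaussDensity measurable_gaussDensity, volume_pi]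
  congr 1
  ext x
  simp_rw [gaussDensity]
  rw [← ENNReal.ofReal_prod_of_nonneg fun i _ => Real.exp_nonneg _, ← Real.exp_sum,
    Finset.mul_sum, Finset.sum_neg_distrib]

/-- The Gaussian measure is invariant under linear maps that preserve the Hermitian norm. -/
theorem gaussVec_map {d : ℕ} (L : (Fin d → ℂ) ≃ₗ[ℂ] (Fin d → ℂ))
    (hL : ∀ x, ∑ i, ‖L x i‖ ^ 2 = ∑ i, ‖x i‖ ^ 2) :
    MeasurePreserving L (gaussVec d) (gaussVec d) := by
  have hLm : Measurable L := L.toLinearMap.continuous_of_finiteDimensional.measurable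
  set ρ : (Fin d → ℂ) → ℝ≥0∞ := fun x => ENNReal.ofReal (Real.exp (-(Real.pi * ∑ i, ‖x i‖ ^ 2)))
    with hρ
  have hρm : Measurable ρ := by rw [hρ]; fun_prop
  have hρL : ∀ x, ρ (L x) = ρ x := fun x => by simp only [hρ, hL]
  -- The factor need not be computed: the density is `L`-invariant, so comparing total masses forces
  -- `c = 1`.
  obtain ⟨c, hc⟩ : ∃ c : ℝ≥0∞, Measure.map L (volume : Measure (Fin d → ℂ)) = c • volume := by
    have hdet : LinearMap.det (L.restrictScalars ℝ).toLinearMap ≠ 0 :=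
      (LinearEquiv.isUnit_det' _).ne_zero
    exact ⟨_, Measure.map_linearMap_addHaar_eq_smul_addHaar volume hdet⟩
  have hmap : Measure.map L (gaussVec d) = c • gaussVec d := by
    ext s hs
    rw [Measure.map_apply hLm hs, Measure.smul_apply, gaussVec_eq,
      withDensity_apply _ (hLm hs), withDensity_apply _ hs]
    calc ∫⁻ a in L ⁻¹' s, ρ a = ∫⁻ a in L ⁻¹' s, ρ (L a) := by simp_rw [hρL]
      _ = ∫⁻ a in s, ρ a ∂(Measure.map L volume) := (setLIntegral_map hs hρm hLm).symm
      _ = c • ∫⁻ a in s, ρ a := by rw [hc, Measure.restrict_smul, lintegral_smul_measure]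
  have h1 : c = 1 := by
    have := congrArg (fun μ => μ Set.univ) hmap
    simpa [Measure.map_apply hLm MeasurableSet.univ] using this.symm
  exact ⟨hLm, by rw [hmap, h1, one_smul]⟩

/-- With `a = (1 - x) / x`, the condition says `a * ∑_{i ≥ 1} |g i|² ≤ |g 0|²`. Given the other
coordinates, the Gaussian tail of `g 0` factorises over them, and each factor integrates to `1 / (1
+ a) = x`. -/
theorem gaussVec_cone_le {D : ℕ} {x : ℝ} (hx : 0 < x) (hx1 : x ≤ 1) :
    gaussVec (D + 1) {g | (1 - x) * ∑ i, ‖g i‖ ^ 2 ≤ ‖g 0‖ ^ 2} ≤ ENNReal.ofReal (x ^ D) := by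
  set a : ℝ := (1 - x) / x with ha
  have ha0 : 0 ≤ a := div_nonneg (by linarith) hx.le
  have hms : MeasurableSet {g : Fin (D + 1) → ℂ | (1 - x) * ∑ i, ‖g i‖ ^ 2 ≤ ‖g 0‖ ^ 2} :=
    measurableSet_le (by fun_prop) (by fun_prop)
  have h := (measurePreserving_piFinSuccAbove (fun _ : Fin (D + 1) => gaussC) 0).symm
  rw [gaussVec, ← h.measure_preimage_equiv, Measure.prod_apply_symm (h.measurable hms)]
  have hfib : ∀ y : Fin D → ℂ, gaussC ((fun z => (z, y)) ⁻¹'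
      ((MeasurableEquiv.piFinSuccAbove (fun _ : Fin (D + 1) => ℂ) 0).symm ⁻¹'
        {g : Fin (D + 1) → ℂ | (1 - x) * ∑ i, ‖g i‖ ^ 2 ≤ ‖g 0‖ ^ 2})) ≤
      ∏ i, ENNReal.ofReal (Real.exp (-(a * (Real.pi * ‖y i‖ ^ 2)))) := by
    intro y
    rw [← ENNReal.ofReal_prod_of_nonneg fun i _ => Real.exp_nonneg _, ← Real.exp_sum]
    have hS : 0 ≤ a * ∑ i, ‖y i‖ ^ 2 := by positivity
    refine (measure_mono ?_).trans ((gaussC_tail_le (Real.sqrt (a * ∑ i, ‖y i‖ ^ 2))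
      (Real.sqrt_nonneg _)).trans_eq ?_)
    · intro z hz
      simp only [Set.mem_preimage, Set.mem_ofPred_eq, MeasurableEquiv.piFinSuccAbove_symm_apply,
        Fin.insertNthEquiv, Equiv.coe_fn_mk, Fin.insertNth_zero, Fin.sum_univ_succ, Fin.cons_zero,
        Fin.cons_succ, cast_eq] at hz
      change Real.sqrt _ ≤ ‖z‖
      rw [Real.sqrt_le_left (norm_nonneg z), ha, div_mul_eq_mul_div, div_le_iff₀ hx]
      nlinarith
    · rw [Real.sq_sqrt hS]
      congr 2
      rw [Finset.sum_neg_distrib, ← Finset.mul_sum, ← Finset.mul_sum]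
      ring
  refine (lintegral_mono hfib).trans_eq ?_
  rw [lintegral_pi_prod gaussC (fun _ z => ENNReal.ofReal (Real.exp (-(a * (Real.pi * ‖z‖ ^ 2)))))
    (fun _ => by fun_prop)]
  simp_rw [lintegral_gaussC_exp ha0]
  rw [Finset.prod_const, Finset.card_univ, Fintype.card_fin, ← ENNReal.ofReal_pow (by positivity)]
  congr 2
  rw [ha]
  field_simp
  ring

/-- Every unit vector is the first vector of an orthonormal basis. -/
theorem exists_unitary_coordinate {D : ℕ} (φ : Fin (D + 1) → ℂ) (hφ : ∑ i, ‖φ i‖ ^ 2 = 1) :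
    ∃ L : (Fin (D + 1) → ℂ) ≃ₗ[ℂ] (Fin (D + 1) → ℂ),
      (∀ x, ∑ i, ‖L x i‖ ^ 2 = ∑ i, ‖x i‖ ^ 2) ∧ ∀ x, L x 0 = ∑ i, star (φ i) * x i := by
  set v : EuclideanSpace ℂ (Fin (D + 1)) := WithLp.toLp 2 φ with hv
  have hnorm : ‖v‖ = 1 := by
    rw [EuclideanSpace.norm_eq, Real.sqrt_eq_one]
    exact hφ
  have ho : Orthonormal ℂ (({0} : Set (Fin (D + 1))).domRestrict
      (fun _ : Fin (D + 1) => v)) := by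
    refine ⟨fun _ => hnorm, fun i j hij => ?_⟩
    exact absurd (Subsingleton.elim i j) hij
  obtain ⟨b, hb⟩ := ho.exists_orthonormalBasis_extension_of_card_eq (by simp)
  refine ⟨(WithLp.linearEquiv 2 ℂ (Fin (D + 1) → ℂ)).symm.trans
    (b.repr.toLinearEquiv.trans (WithLp.linearEquiv 2 ℂ (Fin (D + 1) → ℂ))), fun x => ?_,
    fun x => ?_⟩
  · have h := b.repr.norm_map (WithLp.toLp 2 x)
    have h2 := congrArg (· ^ 2) h
    simp only [EuclideanSpace.norm_sq_eq] at h2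
    exact h2
  · change b.repr (WithLp.toLp 2 x) 0 = _
    rw [b.repr_apply_apply, hb 0 rfl, hv, PiLp.inner_apply]
    exact Finset.sum_congr rfl fun i _ => by
      simp [mul_comm]

theorem gaussVec_overlap_le {D : ℕ} (φ : Fin (D + 1) → ℂ) (hφ : ∑ i, ‖φ i‖ ^ 2 = 1)
    {x : ℝ} (hx : 0 < x) (hx1 : x ≤ 1) :
    gaussVec (D + 1) {g | (1 - x) * ∑ i, ‖g i‖ ^ 2 ≤ ‖∑ i, star (φ i) * g i‖ ^ 2} ≤
      ENNReal.ofReal (x ^ D) := by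
  obtain ⟨L, hL, hL0⟩ := exists_unitary_coordinate φ hφ
  have hms : MeasurableSet {g : Fin (D + 1) → ℂ | (1 - x) * ∑ i, ‖g i‖ ^ 2 ≤ ‖g 0‖ ^ 2} :=
    measurableSet_le (by fun_prop) (by fun_prop)
  have h := (gaussVec_map L hL).measure_preimage hms.nullMeasurableSet
  rw [Set.preimage_ofPred_eq] at h
  simp only [hL, hL0] at h
  rw [h]
  exact gaussVec_cone_le hx hx1

/-! ### Random pure states and their overlap with a fixed state -/

/-- The unit vector in the direction of `g`, and the first basis vector if `g = 0`. -/
noncomputable def unitize {D : ℕ} (g : Fin (D + 1) → ℂ) : Fin (D + 1) → ℂ :=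
  if g = 0 then Pi.single 0 1 else fun i => g i / (Real.sqrt (∑ j, ‖g j‖ ^ 2) : ℂ)

theorem measurable_unitize {D : ℕ} : Measurable (unitize (D := D)) := by
  unfold unitize
  exact Measurable.ite (measurableSet_singleton 0) measurable_const (by fun_prop)

theorem sum_norm_sq_pos {d : ℕ} {g : Fin d → ℂ} (hg : g ≠ 0) : 0 < ∑ j, ‖g j‖ ^ 2 := by
  obtain ⟨i, hi⟩ := Function.ne_iff.mp hg
  exact Finset.sum_pos' (fun _ _ => by positivity)
    ⟨i, Finset.mem_univ i, by have := norm_pos_iff.mpr hi; positivity⟩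

theorem norm_unitize {D : ℕ} (g : Fin (D + 1) → ℂ) : ∑ i, ‖unitize g i‖ ^ 2 = 1 := by
  unfold unitize
  split_ifs with hg
  · rw [Finset.sum_eq_single 0] <;> simp +contextual
  · have hpos := sum_norm_sq_pos hg
    simp_rw [norm_div, div_pow, ← Finset.sum_div, Complex.norm_real, Real.norm_eq_abs, sq_abs,
      Real.sq_sqrt hpos.le]
    exact div_self hpos.ne'

/-- The overlap `⟨u|σ|u⟩`. -/
noncomputable def overlap {d : ℕ} (u : Fin d → ℂ) (σ : Matrix (Fin d) (Fin d) ℂ) : ℝ :=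
  (∑ k, ∑ l, star (u k) * σ k l * u l).re

theorem overlap_vecMulVec {d : ℕ} (u φ : Fin d → ℂ) :
    overlap u (Matrix.vecMulVec φ (star φ)) = ‖∑ i, star (φ i) * u i‖ ^ 2 := by
  have h : ∑ k, ∑ l, star (u k) * (Matrix.vecMulVec φ (star φ)) k l * u l =
      star (∑ i, star (φ i) * u i) * ∑ i, star (φ i) * u i := by
    rw [star_sum, Finset.sum_mul_sum]
    refine Finset.sum_congr rfl fun k _ => Finset.sum_congr rfl fun l _ => ?_
    simp only [Matrix.vecMulVec_apply, Pi.star_apply, star_mul', star_star]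
    ring
  rw [overlap, h, RCLike.star_def, Complex.conj_mul']
  exact_mod_cast Complex.ofReal_re _

/-- The density matrix of a pure state. -/
def PureState.mat {d : ℕ} (σ : PureState d) : Matrix (Fin d) (Fin d) ℂ := σ.1

theorem PureState.exists_vec {d : ℕ} (σ : PureState d) :
    ∃ φ : Fin d → ℂ, ∑ i, ‖φ i‖ ^ 2 = 1 ∧ σ.mat = Matrix.vecMulVec φ (star φ) := σ.2

theorem PureState.continuous_mat {d : ℕ} : Continuous (PureState.mat (d := d)) :=
  continuous_subtype_val

theorem overlap_nonneg {d : ℕ} (u : Fin d → ℂ) (σ : PureState d) : 0 ≤ overlap u σ.mat := by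
  obtain ⟨φ, -, h⟩ := σ.exists_vec
  rw [h, overlap_vecMulVec]
  positivity

theorem overlap_le_one {d : ℕ} (u : Fin d → ℂ) (hu : ∑ i, ‖u i‖ ^ 2 = 1) (σ : PureState d) :
    overlap u σ.mat ≤ 1 := by
  obtain ⟨φ, hφ, h⟩ := σ.exists_vec
  rw [h, overlap_vecMulVec]
  calc ‖∑ i, star (φ i) * u i‖ ^ 2 ≤ (∑ i, ‖φ i‖ * ‖u i‖) ^ 2 := by
        gcongr
        refine (norm_sum_le _ _).trans_eq ?_
        simp
    _ ≤ (∑ i, ‖φ i‖ ^ 2) * ∑ i, ‖u i‖ ^ 2 := Finset.sum_mul_sq_le_sq_mul_sq _ _ _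
    _ = 1 := by rw [hφ, hu, one_mul]

theorem gaussVec_overlap_unitize_le {D : ℕ} (σ : PureState (D + 1)) {x : ℝ} (hx : 0 < x)
    (hx1 : x ≤ 1) :
    gaussVec (D + 1) {g | 1 - x ≤ overlap (unitize g) σ.mat} ≤ ENNReal.ofReal (x ^ D) := by
  obtain ⟨φ, hφ, h⟩ := σ.exists_vec
  refine (measure_mono fun g hg => ?_).trans (gaussVec_overlap_le φ hφ hx hx1)
  simp only [Set.mem_ofPred_eq] at hg ⊢
  by_cases h0 : g = 0
  · simp [h0]
  have hpos := sum_norm_sq_pos h0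
  rw [h, overlap_vecMulVec] at hg
  have : ∑ i, star (φ i) * unitize g i =
      (∑ i, star (φ i) * g i) / (Real.sqrt (∑ j, ‖g j‖ ^ 2) : ℂ) := by
    rw [Finset.sum_div]
    exact Finset.sum_congr rfl fun i _ => by rw [unitize, if_neg h0, mul_div_assoc]
  rw [this, norm_div, div_pow, Complex.norm_real, Real.norm_eq_abs, sq_abs,
    Real.sq_sqrt hpos.le, le_div_iff₀ hpos] at hg
  exact hg

theorem measurable_overlap_unitize {D : ℕ} {α : Type*} [MeasurableSpace α]
    {g : α → Fin (D + 1) → ℂ} {σ : α → Matrix (Fin (D + 1)) (Fin (D + 1)) ℂ} (hg : Measurable g)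
    (hσ : ∀ k l, Measurable fun a => σ a k l) :
    Measurable fun a => overlap (unitize (g a)) (σ a) := by
  unfold overlap
  have h1 : ∀ k, Measurable fun a => unitize (g a) k :=
    fun k => (measurable_pi_apply k).comp (measurable_unitize.comp hg)
  refine Complex.measurable_re.comp (Finset.measurable_fun_sum _ fun k _ =>
    Finset.measurable_fun_sum _ fun l _ => ?_)
  exact ((Complex.continuous_conj.measurable.comp (h1 k)).mul (hσ k l)).mul (h1 l)

/-- Layer-cake: `exp(-λX) = ∫_X^∞ λ exp(-λx) dx`, so the tail bound `P(X ≤ x) ≤ x^D` leaves the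
Gamma integral `∫ λ x^D exp(-λx) dx = D! / λ^D`. -/
theorem lintegral_exp_overlap_le {D : ℕ} (hD : 0 < D) (σ : PureState (D + 1)) {lam : ℝ}
    (hlam : 0 < lam) :
    ∫⁻ g, ENNReal.ofReal (Real.exp (-(lam * (1 - overlap (unitize g) σ.mat)))) ∂gaussVec (D + 1) ≤
      ENNReal.ofReal (D.factorial / lam ^ D) := by
  set X : (Fin (D + 1) → ℂ) → ℝ := fun g => 1 - overlap (unitize g) σ.mat with hX
  have hXm : Measurable X :=
    measurable_const.sub (measurable_overlap_unitize measurable_id fun _ _ => measurable_const)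
  have hX0 : ∀ g, 0 ≤ X g := fun g => sub_nonneg.mpr (overlap_le_one _ (norm_unitize g) σ)
  have htail : ∀ x : ℝ, 0 < x → gaussVec (D + 1) {g | X g ≤ x} ≤ ENNReal.ofReal (x ^ D) := by
    intro x hx
    rcases le_total x 1 with h1 | h1
    · refine (measure_mono fun g hg => ?_).trans (gaussVec_overlap_unitize_le σ hx h1)
      simp only [hX, Set.mem_ofPred_eq] at hg ⊢
      linarith
    · exact prob_le_one.trans (by simpa using one_le_pow₀ h1)
  have hexp : ∀ g, ENNReal.ofReal (Real.exp (-(lam * X g))) =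
      ∫⁻ x in Set.Ioi (0 : ℝ), {x | X g ≤ x}.indicator
        (fun x => ENNReal.ofReal (lam * Real.exp (-(lam * x)))) x := by
    intro g
    have hs : {x : ℝ | X g ≤ x} = Set.Ici (X g) := rfl
    rw [hs, lintegral_indicator measurableSet_Ici, Measure.restrict_restrict measurableSet_Ici,
      Measure.restrict_congr_set (Ioi_ae_eq_Ici.symm.inter (ae_eq_refl (Set.Ioi (0 : ℝ)))),
      Set.Ioi_inter_Ioi, max_eq_left (hX0 g)]
    · have hd : ∀ x ∈ Set.Ici (X g), HasDerivAt (fun r : ℝ => -Real.exp (-(lam * r)))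
          (lam * Real.exp (-(lam * x))) x := by
        intro x _
        have h1 : HasDerivAt (fun r : ℝ => -(lam * r)) (-lam) x := by
          convert! ((hasDerivAt_id x).const_mul lam).neg using 1
          simp
        convert! h1.exp.neg using 1
        ring
      have hlim : Filter.Tendsto (fun r : ℝ => -Real.exp (-(lam * r))) Filter.atTop
          (nhds (-0)) :=
        (Real.tendsto_exp_neg_atTop_nhds_zero.comp
          (Filter.tendsto_id.const_mul_atTop hlam)).neg
      have hnn : ∀ x ∈ Set.Ioi (X g), 0 ≤ lam * Real.exp (-(lam * x)) := fun _ _ => by positivity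
      rw [← ofReal_integral_eq_lintegral_ofReal
        (integrableOn_Ioi_deriv_of_nonneg' hd hnn hlim)
        ((ae_restrict_mem measurableSet_Ioi).mono hnn),
        integral_Ioi_of_hasDerivAt_of_nonneg' hd hnn hlim]
      simp
  refine (lintegral_congr hexp).trans_le ?_
  rw [lintegral_lintegral_swap]
  · have hin : ∀ x ∈ Set.Ioi (0 : ℝ), (∫⁻ g, {x | X g ≤ x}.indicator
        (fun x => ENNReal.ofReal (lam * Real.exp (-(lam * x)))) x ∂gaussVec (D + 1)) ≤
        ENNReal.ofReal (lam * (x ^ (D : ℝ) * Real.exp (-lam * x ^ (1 : ℝ)))) := by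
      intro x hx
      have hx : 0 < x := hx
      have : ∀ g, {x | X g ≤ x}.indicator
          (fun x => ENNReal.ofReal (lam * Real.exp (-(lam * x)))) x =
          {g | X g ≤ x}.indicator
            (fun _ => ENNReal.ofReal (lam * Real.exp (-(lam * x)))) g := fun g => rfl
      simp_rw [this]
      rw [lintegral_indicator_const (measurableSet_le hXm measurable_const)]
      refine (mul_le_mul_right (htail x hx) _).trans_eq ?_
      rw [← ENNReal.ofReal_mul (by positivity), Real.rpow_natCast, Real.rpow_one]
      congr 1
      rw [neg_mul]
      ring
    refine (setLIntegral_mono' measurableSet_Ioi hin).trans_eq ?_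
    have hI := integral_rpow_mul_exp_neg_mul_rpow (p := 1) (q := D) (b := lam) one_pos
      (neg_one_lt_zero.trans_le (Nat.cast_nonneg D)) hlam
    have hval : ∫ x in Set.Ioi (0 : ℝ), lam * (x ^ (D : ℝ) * Real.exp (-lam * x ^ (1 : ℝ))) =
        D.factorial / lam ^ D := by
      rw [integral_const_mul, hI, div_one, div_one, div_one, mul_one, Real.Gamma_nat_eq_factorial,
        ← Nat.cast_add_one, Real.rpow_neg hlam.le, Real.rpow_natCast]
      field_simp
      ring
    rw [← hval, ofReal_integral_eq_lintegral_ofReal]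
    · refine Integrable.const_mul (not_imp_comm.mp integral_undef ?_) _
      rw [hI]
      have := Real.Gamma_pos_of_pos (s := ((D : ℝ) + 1) / 1) (by positivity)
      positivity
    · filter_upwards [ae_restrict_mem measurableSet_Ioi] with x hx
      have : (0 : ℝ) < x := hx
      change 0 ≤ _
      positivity
  · refine Measurable.aemeasurable ?_
    have : (Function.uncurry fun (g : Fin (D + 1) → ℂ) (x : ℝ) => {x | X g ≤ x}.indicator
        (fun x => ENNReal.ofReal (lam * Real.exp (-(lam * x)))) x) =
        {q : (Fin (D + 1) → ℂ) × ℝ | X q.1 ≤ q.2}.indicator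
          fun q => ENNReal.ofReal (lam * Real.exp (-(lam * q.2))) := rfl
    rw [this]
    exact Measurable.indicator (by fun_prop)
      (measurableSet_le (hXm.comp measurable_fst) measurable_snd)

/-! ### Random product states close to a fixed product state -/

/-- The law of `n` independent Gaussian vectors. -/
noncomputable def gaussProd (n d : ℕ) : Measure (Fin n → Fin d → ℂ) :=
  Measure.pi fun _ => gaussVec d

instance (n d : ℕ) : IsProbabilityMeasure (gaussProd n d) := by
  unfold gaussProd; infer_instance

/-- All factors lie in `[0, 1]`, so each one is at least the product; the sites are independent. -/
theorem gaussProd_le_pow {n D : ℕ} (σ : Fin n → PureState (D + 1)) {ε : ℝ}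
    (h0 : 0 < ε) (h1 : ε ≤ 1) :
    gaussProd n (D + 1) {g | 1 - ε ≤ ∏ i, overlap (unitize (g i)) (σ i).mat} ≤
      ENNReal.ofReal ((ε ^ D) ^ n) := by
  have hsub : {g : Fin n → Fin (D + 1) → ℂ | 1 - ε ≤ ∏ i, overlap (unitize (g i)) (σ i).mat} ⊆
      Set.univ.pi fun i => {g | 1 - ε ≤ overlap (unitize g) (σ i).mat} := by
    intro g hg i _
    simp only [Set.mem_ofPred_eq] at hg ⊢
    refine le_trans hg ?_
    rw [← Finset.mul_prod_erase _ _ (Finset.mem_univ i)]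
    exact mul_le_of_le_one_right (overlap_nonneg _ _)
      (Finset.prod_le_one (fun j _ => overlap_nonneg _ _)
        fun j _ => overlap_le_one _ (norm_unitize _) _)
  refine (measure_mono hsub).trans ?_
  rw [gaussProd, Measure.pi_pi]
  refine (Finset.prod_le_prod' fun i _ => gaussVec_overlap_unitize_le (σ i) h0 h1).trans_eq ?_
  rw [Finset.prod_const, Finset.card_univ, Fintype.card_fin,
    ENNReal.ofReal_pow (pow_nonneg h0.le D)]

/-- The inequality `log y ≤ y - 1` is used at each `F i` and at the inverse of the product. It turns
high fidelity into a bound on the sum of the site errors, as the Chernoff argument needs. -/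
theorem sum_one_sub_le {n : ℕ} {F : Fin n → ℝ} {ε : ℝ} (h1 : ε < 1)
    (hF0 : ∀ i, 0 ≤ F i) (h : 1 - ε ≤ ∏ i, F i) : ∑ i, (1 - F i) ≤ ε / (1 - ε) := by
  have hq : 0 < 1 - ε := by linarith
  have hprod : 0 < ∏ i, F i := hq.trans_le h
  have hne : ∀ i, F i ≠ 0 := fun i =>
    Finset.prod_ne_zero_iff.mp hprod.ne' i (Finset.mem_univ i)
  calc ∑ i, (1 - F i) ≤ ∑ i, -Real.log (F i) := Finset.sum_le_sum fun i _ => by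
        have := Real.log_le_sub_one_of_pos ((hF0 i).lt_of_ne (hne i).symm)
        linarith
    _ = Real.log (∏ i, F i)⁻¹ := by
        rw [Finset.sum_neg_distrib, ← Real.log_prod fun i _ => hne i, Real.log_inv]
    _ ≤ (∏ i, F i)⁻¹ - 1 := Real.log_le_sub_one_of_pos (inv_pos.mpr hprod)
    _ ≤ (1 - ε)⁻¹ - 1 := by gcongr
    _ = ε / (1 - ε) := by field_simp; ring

/-- Chernoff: on the event, `exp(λ (ε/(1-ε) - ∑ (1 - F i))) ≥ 1`, and its expectation factorises
over the sites. -/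
theorem gaussProd_le_exp {n D : ℕ} (hD : 0 < D) (σ : Fin n → PureState (D + 1)) {ε lam : ℝ}
    (h1 : ε < 1) (hlam : 0 < lam) :
    gaussProd n (D + 1) {g | 1 - ε ≤ ∏ i, overlap (unitize (g i)) (σ i).mat} ≤
      ENNReal.ofReal (Real.exp (lam * (ε / (1 - ε))) * (D.factorial / lam ^ D) ^ n) := by
  have hm : ∀ i, Measurable fun g : Fin (D + 1) → ℂ => overlap (unitize g) (σ i).mat := fun i =>
    measurable_overlap_unitize measurable_id fun _ _ => measurable_const
  have hms : MeasurableSet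
      {g : Fin n → Fin (D + 1) → ℂ | 1 - ε ≤ ∏ i, overlap (unitize (g i)) (σ i).mat} :=
    measurableSet_le measurable_const
      (Finset.measurable_fun_prod _ fun i _ => (hm i).comp (measurable_pi_apply i))
  rw [← lintegral_indicator_one hms]
  calc _ ≤ ∫⁻ g : Fin n → Fin (D + 1) → ℂ, ENNReal.ofReal (Real.exp (lam * (ε / (1 - ε)))) *
        ∏ i, ENNReal.ofReal (Real.exp (-(lam * (1 - overlap (unitize (g i)) (σ i).mat))))
        ∂gaussProd n (D + 1) := by
        refine lintegral_mono (Set.indicator_le fun g hg => ?_)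
        simp only [Set.mem_ofPred_eq] at hg
        rw [← ENNReal.ofReal_prod_of_nonneg fun i _ => Real.exp_nonneg _,
          ← ENNReal.ofReal_mul (Real.exp_nonneg _), ← Real.exp_sum, ← Real.exp_add, Pi.one_apply,
          ENNReal.one_le_ofReal, Real.one_le_exp_iff, Finset.sum_neg_distrib, ← Finset.mul_sum]
        have := mul_le_mul_of_nonneg_left
          (sum_one_sub_le h1 (fun i => overlap_nonneg (unitize (g i)) (σ i)) hg) hlam.le
        linarith
    _ = ENNReal.ofReal (Real.exp (lam * (ε / (1 - ε)))) * ∏ i, ∫⁻ g,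
          ENNReal.ofReal (Real.exp (-(lam * (1 - overlap (unitize g) (σ i).mat))))
          ∂gaussVec (D + 1) := by
        rw [lintegral_const_mul' _ _ ENNReal.ofReal_ne_top, gaussProd]
        rw [lintegral_pi_prod (gaussVec (D + 1)) (fun i g => ENNReal.ofReal
          (Real.exp (-(lam * (1 - overlap (unitize g) (σ i).mat)))))]
        intro i
        have := hm i
        fun_prop
    _ ≤ _ := by
        rw [ENNReal.ofReal_mul (Real.exp_nonneg _), ENNReal.ofReal_pow (by positivity)]
        gcongr
        refine (Finset.prod_le_prod' fun i _ => lintegral_exp_overlap_le hD (σ i) hlam).trans_eq ?_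
        rw [Finset.prod_const, Finset.card_univ, Fintype.card_fin]

/-! ### Projections onto fibrewise constant functions -/

/-- The orthogonal projection onto the functions that are constant on the fibres of `t`. -/
noncomputable def fiberProj {I T : Type*} [Fintype I] [DecidableEq T] (t : I → T) : Matrix I I ℂ :=
  Matrix.of fun x y =>
    if t x = t y then ((Finset.univ.filter fun z => t z = t x).card : ℂ)⁻¹ else 0

section fiberProj

variable {I T : Type*} [Fintype I] [DecidableEq T] (t : I → T)

theorem card_fiber_ne_zero (x : I) : ((Finset.univ.filter fun z => t z = t x).card : ℂ) ≠ 0 :=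
  Nat.cast_ne_zero.mpr (Finset.card_ne_zero.mpr ⟨x, by simp⟩)

theorem fiberProj_isHermitian : (fiberProj t).IsHermitian := by
  ext x y
  simp only [fiberProj, Matrix.conjTranspose_apply, Matrix.of_apply]
  by_cases h : t x = t y
  · simp [h]
  · simp [h, Ne.symm h]

theorem fiberProj_mulVec {v : I → ℂ} (hv : ∀ x y, t x = t y → v x = v y) :
    (fiberProj t).mulVec v = v := by
  ext x
  simp only [fiberProj, Matrix.mulVec, dotProduct, Matrix.of_apply, ite_mul, zero_mul]
  rw [← Finset.sum_filter]
  have h : ∀ y ∈ Finset.univ.filter (fun y => t x = t y),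
      ((Finset.univ.filter fun z => t z = t x).card : ℂ)⁻¹ * v y =
      ((Finset.univ.filter fun z => t z = t x).card : ℂ)⁻¹ * v x := fun y hy => by
    rw [hv x y (Finset.mem_filter.mp hy).2]
  rw [Finset.sum_congr rfl h, Finset.sum_const, nsmul_eq_mul]
  simp_rw [eq_comm (a := t x)]
  rw [mul_inv_cancel_left₀ (card_fiber_ne_zero t x)]

theorem fiberProj_mul_self : fiberProj t * fiberProj t = fiberProj t := by
  ext x y
  have h := fiberProj_mulVec t (v := fun x => fiberProj t x y) fun a b hab => by
    simp only [fiberProj, Matrix.of_apply, hab]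
  exact congrFun h x

/-- Each nonempty fibre contributes exactly `1` to the trace. -/
theorem trace_fiberProj_le [Fintype T] : (fiberProj t).trace.re ≤ Fintype.card T := by
  have h : (fiberProj t).trace.re =
      ∑ x, ((Finset.univ.filter fun z => t z = t x).card : ℝ)⁻¹ := by
    simp only [Matrix.trace, Matrix.diag_apply, fiberProj, Matrix.of_apply, if_true]
    rw [Complex.re_sum]
    refine Finset.sum_congr rfl fun x _ => ?_
    rw [← Complex.ofReal_natCast, ← Complex.ofReal_inv, Complex.ofReal_re]
  rw [h, ← Finset.sum_fiberwise_of_maps_to (g := t) fun x _ => Finset.mem_univ (t x)]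
  calc _ ≤ ∑ τ : T, (1 : ℝ) := Finset.sum_le_sum fun τ _ => ?_
    _ = _ := by simp
  rw [Finset.sum_congr rfl (g := fun _ => ((Finset.univ.filter fun z => t z = τ).card : ℝ)⁻¹)
    fun x hx => by rw [(Finset.mem_filter.mp hx).2], Finset.sum_const, nsmul_eq_mul]
  exact mul_inv_le_one

end fiberProj

/-- By cyclicity `tr(E Q) = tr(Q E Q)`, and `Q E Q` is positive semidefinite. -/
theorem trace_mul_nonneg_of_isProj {I : Type*} [Fintype I] [DecidableEq I] {E Q : Matrix I I ℂ}
    (hE : E.PosSemidef) (hQ : Q.IsHermitian) (hQ2 : Q * Q = Q) : 0 ≤ (E * Q).trace.re := by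
  have h := (hE.conjTranspose_mul_mul_same Q).trace_nonneg
  rw [hQ.eq, Matrix.trace_mul_comm, ← Matrix.mul_assoc, hQ2, Matrix.trace_mul_comm] at h
  exact (Complex.le_def.mp h).1

theorem star_dotProduct_self_eq {I : Type*} [Fintype I] (v : I → ℂ) :
    dotProduct (star v) v = ((∑ i, ‖v i‖ ^ 2 : ℝ) : ℂ) := by
  simp only [dotProduct, Pi.star_apply, RCLike.star_def, Complex.conj_mul']
  push_cast
  rfl

/-- Since `v` lies in the range of the projection, `fiberProj t - |v⟩⟨v|` is again a projection. -/
theorem trace_mul_vecMulVec_le {I T : Type*} [Fintype I] [DecidableEq I] [DecidableEq T]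
    (t : I → T) {v : I → ℂ} (hv : ∀ x y, t x = t y → v x = v y) (hv1 : ∑ i, ‖v i‖ ^ 2 = 1)
    {E : Matrix I I ℂ} (hE : E.PosSemidef) :
    (E * Matrix.vecMulVec v (star v)).trace.re ≤ (E * fiberProj t).trace.re := by
  have hW := fiberProj_isHermitian t
  have hR : (Matrix.vecMulVec v (star v)).IsHermitian := by
    rw [Matrix.IsHermitian, Matrix.conjTranspose_vecMulVec, star_star]
  have hWR : fiberProj t * Matrix.vecMulVec v (star v) = Matrix.vecMulVec v (star v) := by
    rw [Matrix.mul_vecMulVec, fiberProj_mulVec t hv]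
  have hRW : Matrix.vecMulVec v (star v) * fiberProj t = Matrix.vecMulVec v (star v) := by
    have := congrArg Matrix.conjTranspose hWR
    rwa [Matrix.conjTranspose_mul, hR.eq, hW.eq] at this
  have hRR : Matrix.vecMulVec v (star v) * Matrix.vecMulVec v (star v) =
      Matrix.vecMulVec v (star v) := by
    rw [Matrix.vecMulVec_mul_vecMulVec, star_dotProduct_self_eq, hv1]
    simp
  have h := trace_mul_nonneg_of_isProj hE (hW.sub hR) (by
    rw [sub_mul, mul_sub, mul_sub, fiberProj_mul_self, hWR, hRW, hRR, sub_self, sub_zero])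
  rw [mul_sub, Matrix.trace_sub, Complex.sub_re] at h
  linarith

/-! ### Product vectors, fidelity and the symmetric subspace -/

/-- The tensor product of vectors. -/
noncomputable def tensorVec {k : ℕ} {ι : Type*} (ψ : Fin k → ι → ℂ) : (Fin k → ι) → ℂ :=
  fun x => ∏ i, ψ i (x i)

theorem tensor_vecMulVec {k : ℕ} {ι : Type*} (ψ : Fin k → ι → ℂ) :
    tensor (fun i => Matrix.vecMulVec (ψ i) (star (ψ i))) =
      Matrix.vecMulVec (tensorVec ψ) (star (tensorVec ψ)) := by
  ext x y
  simp [tensor, tensorVec, Matrix.vecMulVec_apply, Finset.prod_mul_distrib]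

theorem sum_prod_pi {k : ℕ} {ι R : Type*} [Fintype ι] [CommSemiring R] (f : Fin k → ι → R) :
    ∑ x : Fin k → ι, ∏ i, f i (x i) = ∏ i, ∑ a, f i a := by
  classical
  rw [Finset.prod_univ_sum, Fintype.piFinset_univ]

theorem norm_tensorVec {k : ℕ} {ι : Type*} [Fintype ι] (ψ : Fin k → ι → ℂ)
    (h : ∀ i, ∑ a, ‖ψ i a‖ ^ 2 = 1) : ∑ x, ‖tensorVec ψ x‖ ^ 2 = 1 := by
  simp_rw [tensorVec, norm_prod, ← Finset.prod_pow]
  rw [sum_prod_pi fun i a => ‖ψ i a‖ ^ 2]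
  exact Finset.prod_eq_one fun i _ => h i

theorem sum_star_tensorVec {k : ℕ} {ι : Type*} [Fintype ι] (φ ψ : Fin k → ι → ℂ) :
    ∑ x, star (tensorVec φ x) * tensorVec ψ x = ∏ i, ∑ a, star (φ i a) * ψ i a := by
  simp_rw [tensorVec, star_prod, ← Finset.prod_mul_distrib]
  exact sum_prod_pi fun i a => star (φ i a) * ψ i a

/-- The projection `|v⟩⟨v|` is its own square root, so the inner matrix is `|c|² |v⟩⟨v|` with `c =
⟨w|v⟩`, and its root `|c| |v⟩⟨v|` has trace `|c|`. -/
theorem fidelity_vecMulVec {I : Type*} [Fintype I] [DecidableEq I] (v w : I → ℂ)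
    (hv : ∑ i, ‖v i‖ ^ 2 = 1) :
    fidelity (Matrix.vecMulVec v (star v)) (Matrix.vecMulVec w (star w)) =
      ‖∑ i, star (w i) * v i‖ ^ 2 := by
  have hvv : dotProduct (star v) v = 1 := by rw [star_dotProduct_self_eq, hv]; simp
  have hR0 : (0 : Matrix I I ℂ) ≤ Matrix.vecMulVec v (star v) :=
    Matrix.nonneg_iff_posSemidef.mpr (Matrix.posSemidef_vecMulVec_self_star v)
  have hRR : Matrix.vecMulVec v (star v) * Matrix.vecMulVec v (star v) =
      Matrix.vecMulVec v (star v) := by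
    rw [Matrix.vecMulVec_mul_vecMulVec, hvv]
    simp
  have hs : CFC.sqrt (Matrix.vecMulVec v (star v)) = Matrix.vecMulVec v (star v) :=
    CFC.sqrt_unique hRR hR0
  set c : ℂ := ∑ i, star (w i) * v i with hc
  have hwv : dotProduct (star w) v = c := rfl
  have hvw : dotProduct (star v) w = star c := by
    rw [← hwv, Matrix.star_dotProduct]
  have hm : Matrix.vecMulVec v (star v) * Matrix.vecMulVec w (star w) *
      Matrix.vecMulVec v (star v) = (((‖c‖ : ℝ) : ℂ) ^ 2) • Matrix.vecMulVec v (star v) := by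
    rw [Matrix.vecMulVec_mul_vecMulVec, Matrix.vecMulVec_mul_vecMulVec, hvw, smul_dotProduct,
      hwv, ← Complex.conj_mul']
    simp [Matrix.vecMulVec_smul]
  have hs2 : CFC.sqrt ((((‖c‖ : ℝ) : ℂ) ^ 2) • Matrix.vecMulVec v (star v)) =
      ((‖c‖ : ℝ) : ℂ) • Matrix.vecMulVec v (star v) := by
    refine CFC.sqrt_unique ?_ ?_
    · rw [smul_mul_smul_comm, hRR, sq]
    · exact smul_nonneg (Complex.zero_le_real.mpr (norm_nonneg c)) hR0
  rw [fidelity, hs, hm, hs2, Matrix.trace_smul, Matrix.trace_vecMulVec, dotProduct_comm, hvv]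
  simp

/-- The types of the columns of `x`: how often each basis vector occurs on each site. -/
def siteType {n d m : ℕ} (x : Fin m → Fin n → Fin d) : Fin n → Sym (Fin d) m :=
  fun i => ⟨Finset.univ.val.map fun j => x j i, by simp⟩

/-- At each site, all copies carry the same vector, so only the multiset of indices occurring there
matters. -/
theorem tensorVec_copies_congr {n d m : ℕ} (ψ : Fin n → Fin d → ℂ)
    (x y : Fin m → Fin n → Fin d) (h : siteType x = siteType y) :
    tensorVec (fun _ : Fin m => tensorVec ψ) x = tensorVec (fun _ : Fin m => tensorVec ψ) y := by
  have key : ∀ z : Fin m → Fin n → Fin d, tensorVec (fun _ : Fin m => tensorVec ψ) z =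
      ∏ i, ((siteType z i).1.map (ψ i)).prod := by
    intro z
    simp only [tensorVec]
    rw [Finset.prod_comm]
    refine Finset.prod_congr rfl fun i _ => ?_
    simp [siteType, Finset.prod, Function.comp_def]
  rw [key, key, h]

theorem card_siteType (n D m : ℕ) :
    Fintype.card (Fin n → Sym (Fin (D + 1)) m) = ((m + D).choose m) ^ n := by
  rw [Fintype.card_fun, Sym.card_sym_eq_choose, Fintype.card_fin, Fintype.card_fin]
  congr 2
  omega

/-! ### The averaging argument -/

theorem POVM.exists_measure {Ω I : Type*} [MeasurableSpace Ω] [Fintype I] [DecidableEq I]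
    (M : POVM Ω I) {W : Matrix I I ℂ} (hW : W.IsHermitian) (hW2 : W * W = W) :
    ∃ μ : Measure Ω, IsFiniteMeasure μ ∧
      ∀ S, MeasurableSet S → μ S = ENNReal.ofReal (M.effect S * W).trace.re := by
  let f : Matrix I I ℂ →+ ℝ :=
    { toFun := fun E => (E * W).trace.re
      map_zero' := by simp
      map_add' := fun A B => by rw [add_mul, Matrix.trace_add, Complex.add_re] }
  have hf : Continuous f :=
    Complex.continuous_re.comp (continuous_id.matrix_mul continuous_const).matrix_trace
  let s : SignedMeasure Ω := M.effect.mapRange f hf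
  have hs : ∀ S, s S = (M.effect S * W).trace.re := fun S => VectorMeasure.mapRange_apply _ hf
  have hnn : ∀ S, 0 ≤ s S := fun S => by
    rw [hs]; exact trace_mul_nonneg_of_isProj (M.posSemidef S) hW hW2
  have h0 : VectorMeasure.restrict 0 Set.univ ≤ VectorMeasure.restrict s Set.univ :=
    VectorMeasure.restrict_le_restrict_of_subset_le _ _ fun S _ _ => hnn S
  refine ⟨s.toMeasureOfZeroLE Set.univ MeasurableSet.univ h0, inferInstance, fun S hS => ?_⟩
  rw [SignedMeasure.toMeasureOfZeroLE_apply _ h0 MeasurableSet.univ hS, ENNReal.ofReal, ← hs]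
  congr 1
  refine NNReal.coe_injective ?_
  rw [Real.coe_toNNReal _ (hnn S)]
  simp

/-- The pure state of a unit vector. -/
def PureState.ofVec {d : ℕ} (u : Fin d → ℂ) (hu : ∑ i, ‖u i‖ ^ 2 = 1) : PureState d :=
  ⟨Matrix.vecMulVec u (star u), u, hu, rfl⟩

theorem productState_ofVec {n d : ℕ} (u : Fin n → Fin d → ℂ) (hu : ∀ i, ∑ a, ‖u i a‖ ^ 2 = 1) :
    productState (fun i => PureState.ofVec (u i) (hu i)) =
      Matrix.vecMulVec (tensorVec u) (star (tensorVec u)) :=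
  tensor_vecMulVec u

theorem fidelity_productState {n d : ℕ} (u : Fin n → Fin d → ℂ)
    (hu : ∀ i, ∑ a, ‖u i a‖ ^ 2 = 1) (σ : Fin n → PureState d) :
    fidelity (productState fun i => PureState.ofVec (u i) (hu i)) (productState σ) =
      ∏ i, overlap (u i) (σ i).mat := by
  choose φ hφ h using fun i => (σ i).exists_vec
  have hσ : productState σ = Matrix.vecMulVec (tensorVec φ) (star (tensorVec φ)) := by
    rw [← tensor_vecMulVec]
    exact congrArg tensor (funext h)
  rw [productState_ofVec, hσ, fidelity_vecMulVec _ _ (norm_tensorVec u hu), sum_star_tensorVec,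
    norm_prod, ← Finset.prod_pow]
  exact Finset.prod_congr rfl fun i _ => by rw [h, overlap_vecMulVec]

theorem ProductLearner.Learns.le_of_gaussProd_le {n D m : ℕ} {A : ProductLearner n (D + 1) m}
    {ε p : ℝ} (hA : A.Learns ε p) {b : ℝ} (hb : 0 ≤ b)
    (hB : ∀ σ : Fin n → PureState (D + 1), gaussProd n (D + 1)
      {g | 1 - ε ≤ ∏ i, overlap (unitize (g i)) (σ i).mat} ≤ ENNReal.ofReal b) :
    p ≤ ((m + D).choose m : ℝ) ^ n * b := by
  classical
  obtain ⟨μ, hμf, hμ⟩ := POVM.exists_measure A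
    (fiberProj_isHermitian (siteType (n := n) (d := D + 1) (m := m))) (fiberProj_mul_self _)
  set R : Set ((Fin n → Fin (D + 1) → ℂ) × (Fin n → PureState (D + 1))) :=
    {q | 1 - ε ≤ ∏ i, overlap (unitize (q.1 i)) (q.2 i).mat} with hR
  have hRm : MeasurableSet R := by
    refine measurableSet_le measurable_const (Finset.measurable_fun_prod _ fun i _ =>
      measurable_overlap_unitize ((measurable_pi_apply i).comp measurable_fst) fun k l => ?_)
    have hc : Measurable fun σ : PureState (D + 1) => σ.mat k l :=
      (PureState.continuous_mat.matrix_elem k l).measurable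
    exact hc.comp ((measurable_pi_apply i).comp measurable_snd)
  have hlow : ∀ g, ENNReal.ofReal p ≤ μ (Prod.mk g ⁻¹' R) := by
    intro g
    -- The default value of `unitize` at `0` makes this hold for every `g`, with no null set to
    -- discard.
    have hu : ∀ i, ∑ a, ‖unitize (g i) a‖ ^ 2 = 1 := fun i => norm_unitize (g i)
    have h := hA fun i => PureState.ofVec (unitize (g i)) (hu i)
    simp_rw [fidelity_productState] at h
    rw [POVM.prob, productState_ofVec, copies, tensor_vecMulVec] at h
    rw [hμ _ (measurable_prodMk_left hRm)]
    refine ENNReal.ofReal_le_ofReal (h.trans ?_)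
    exact trace_mul_vecMulVec_le siteType (tensorVec_copies_congr _)
      (norm_tensorVec _ fun _ => norm_tensorVec _ hu) (A.posSemidef _)
  have hup : μ Set.univ ≤ ENNReal.ofReal (((m + D).choose m : ℝ) ^ n) := by
    rw [hμ _ MeasurableSet.univ, A.total, one_mul]
    refine ENNReal.ofReal_le_ofReal ((trace_fiberProj_le _).trans_eq ?_)
    rw [card_siteType]
    push_cast
    rfl
  have hmain : ENNReal.ofReal p ≤ ENNReal.ofReal (((m + D).choose m : ℝ) ^ n * b) := by
    calc ENNReal.ofReal p = ∫⁻ _, ENNReal.ofReal p ∂gaussProd n (D + 1) := by simp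
      _ ≤ ∫⁻ g, μ (Prod.mk g ⁻¹' R) ∂gaussProd n (D + 1) := lintegral_mono hlow
      _ = ∫⁻ σ, gaussProd n (D + 1) ((fun g => (g, σ)) ⁻¹' R) ∂μ := by
          rw [← Measure.prod_apply hRm, Measure.prod_apply_symm hRm]
      _ ≤ ∫⁻ _, ENNReal.ofReal b ∂μ := lintegral_mono fun σ => hB σ
      _ = ENNReal.ofReal b * μ Set.univ := lintegral_const _
      _ ≤ ENNReal.ofReal b * ENNReal.ofReal (((m + D).choose m : ℝ) ^ n) := by gcongr
      _ = _ := by rw [← ENNReal.ofReal_mul hb, mul_comm]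
  exact (ENNReal.ofReal_le_ofReal_iff (by positivity)).mp hmain

/-! ### From volume bounds to bounds on the number of copies -/

theorem le_of_le_pow {p y : ℝ} {N : ℕ} (hp1 : p < 1) (hy : 0 ≤ y) (hN : N ≠ 0)
    (h : p ≤ y ^ N) : p ≤ y := by
  by_contra! hlt
  exact absurd (h.trans (pow_le_of_le_one hy (hlt.trans hp1).le hN)) (not_le.mpr hlt)

theorem choose_mul_factorial_le (m D : ℕ) :
    ((m + D).choose m : ℝ) * D.factorial ≤ ((m : ℝ) + D) ^ D := by
  have h := Nat.descFactorial_le_pow (m + D) D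
  rw [Nat.descFactorial_eq_factorial_mul_choose, Nat.choose_symm_add.symm, mul_comm] at h
  exact_mod_cast h

theorem choose_mul_pow_le (N m : ℕ) {x : ℝ} (hx : 0 ≤ x) :
    (N.choose m : ℝ) * x ^ m ≤ (1 + x) ^ N := by
  rcases lt_or_ge N m with h | h
  · rw [Nat.choose_eq_zero_of_lt h]
    simp only [Nat.cast_zero, zero_mul]
    positivity
  · rw [add_comm, add_pow]
    refine le_trans (le_of_eq ?_) (Finset.single_le_sum
      (f := fun k => x ^ k * 1 ^ (N - k) * (N.choose k : ℝ)) (fun k _ => by positivity)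
      (Finset.mem_range.mpr (Nat.lt_succ_of_le h)))
    simp [mul_comm]

theorem ProductLearner.Learns.site_le {n D m : ℕ} {A : ProductLearner n (D + 1) m} {ε p : ℝ}
    (hA : A.Learns ε p) (hn : n ≠ 0) (hp1 : p < 1) (hε : 0 < ε) (hεp : ε < p) :
    p ≤ ((m + D).choose m : ℝ) * ε ^ D := by
  have h := hA.le_of_gaussProd_le (b := (ε ^ D) ^ n) (by positivity)
    fun σ => gaussProd_le_pow σ hε (hεp.trans hp1).le
  rw [← mul_pow] at h
  exact le_of_le_pow hp1 (by positivity) hn h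

theorem ProductLearner.Learns.le_add {n D m : ℕ} {A : ProductLearner n (D + 1) m} {ε p : ℝ}
    (hA : A.Learns ε p) (hn : n ≠ 0) (hD : D ≠ 0) (hp1 : p < 1) (hε : 0 < ε) (hεp : ε < p) :
    p * Real.exp (-(1 / (1 - p))) * (n * D / ε) ≤ m + D := by
  have hn' : (0 : ℝ) < n := by positivity
  have hD' : (0 : ℝ) < D := by positivity
  -- With this `λ`, the Chernoff factor is `exp(nD/(1-ε))`, so the whole bound becomes a `(D n)`-th
  -- power.
  set lam : ℝ := n * D / ε with hlam
  have hlam0 : 0 < lam := by positivity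
  have h := hA.le_of_gaussProd_le
    (b := Real.exp (lam * (ε / (1 - ε))) * (D.factorial / lam ^ D) ^ n) (by positivity)
    fun σ => gaussProd_le_exp (Nat.pos_of_ne_zero hD) σ (hεp.trans hp1) hlam0
  have hexp : Real.exp (lam * (ε / (1 - ε))) ≤ Real.exp (1 / (1 - p)) ^ (D * n) := by
    rw [← Real.exp_nat_mul, Real.exp_le_exp]
    have e : lam * (ε / (1 - ε)) = ((D * n : ℕ) : ℝ) * (1 / (1 - ε)) := by
      rw [hlam]; push_cast; field_simp
    rw [e]
    have : 0 < 1 - p := by linarith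
    gcongr
  have h2 : p ≤ (Real.exp (1 / (1 - p)) * ((m + D) / lam)) ^ (D * n) := by
    calc p ≤ _ := h
      _ = Real.exp (lam * (ε / (1 - ε))) *
          (((m + D).choose m : ℝ) * D.factorial / lam ^ D) ^ n := by
          rw [mul_div_assoc, mul_pow]; ring
      _ ≤ Real.exp (1 / (1 - p)) ^ (D * n) * (((m : ℝ) + D) ^ D / lam ^ D) ^ n := by
          have := choose_mul_factorial_le m D
          gcongr
      _ = _ := by rw [← div_pow, ← pow_mul, mul_pow]
  have h3 := le_of_le_pow hp1 (by positivity) (Nat.mul_ne_zero hD hn) h2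
  rw [← mul_div_assoc, le_div_iff₀ hlam0] at h3
  rw [Real.exp_neg, mul_right_comm, ← div_eq_mul_inv, div_le_iff₀ (Real.exp_pos _)]
  linarith

theorem ProductLearner.Learns.ne_zero {n D m : ℕ} {A : ProductLearner n (D + 1) m} {ε p : ℝ}
    (hA : A.Learns ε p) (hn : n ≠ 0) (hD : D ≠ 0) (hp1 : p < 1) (hε : 0 < ε) (hεp : ε < p) :
    m ≠ 0 := by
  rintro rfl
  have h := hA.site_le hn hp1 hε hεp
  rw [Nat.choose_zero_right, Nat.cast_one, one_mul] at h
  exact absurd (h.trans (pow_le_of_le_one hε.le (hεp.trans hp1).le hD)) (not_le.mpr hεp)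

theorem exists_dim_le (p : ℝ) (hp0 : 0 < p) (hp1 : p < 1) :
    ∃ β : ℝ, 0 < β ∧ ∀ (n D m : ℕ) (A : ProductLearner n (D + 1) m) (ε : ℝ), n ≠ 0 → D ≠ 0 →
      0 < ε → ε < p → A.Learns ε p → (D : ℝ) ≤ β * m := by
  -- Chosen so that `(1 + x) * p = (1 + p) / 2 < 1`: the growth of the binomial coefficient in `D`
  -- is then beaten by `p ^ D`.
  set x : ℝ := (1 - p) / (2 * p) with hx
  have hx0 : 0 < x := div_pos (by linarith) (by positivity)
  set r : ℝ := (1 + p) / 2 with hr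
  have hr0 : 0 < r := by positivity
  have hr1 : r < 1 := by rw [hr]; linarith
  have hxr : (1 + x) * p = r := by rw [hx, hr]; field_simp; ring
  have hb1 : 0 < -Real.log r := neg_pos.mpr (Real.log_neg hr0 hr1)
  have hB : 0 < Real.log ((1 + x) / x) :=
    Real.log_pos ((one_lt_div hx0).mpr (by linarith))
  have hlp : 0 < -Real.log p := neg_pos.mpr (Real.log_neg hp0 hp1)
  refine ⟨(Real.log ((1 + x) / x) + -Real.log p) / -Real.log r, by positivity, ?_⟩
  intro n D m A ε hn hD hε hεp hA
  have hm : (1 : ℝ) ≤ m :=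
    Nat.one_le_cast.mpr (Nat.one_le_iff_ne_zero.mpr (hA.ne_zero hn hD hp1 hε hεp))
  have h1 : p ≤ r ^ D * ((1 + x) / x) ^ m := by
    calc p ≤ ((m + D).choose m : ℝ) * ε ^ D := hA.site_le hn hp1 hε hεp
      _ ≤ ((m + D).choose m : ℝ) * p ^ D := by gcongr
      _ ≤ ((1 + x) ^ (m + D) / x ^ m) * p ^ D := by
          gcongr
          rw [le_div_iff₀ (by positivity)]
          exact choose_mul_pow_le _ _ hx0.le
      _ = _ := by
          clear_value x
          rw [← hxr, mul_pow, div_pow, pow_add]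
          ring
  have h2 := Real.log_le_log hp0 h1
  rw [Real.log_mul (by positivity) (by positivity), Real.log_pow, Real.log_pow] at h2
  rw [div_mul_eq_mul_div, le_div_iff₀ hb1]
  -- As `m ≥ 1`, the constant `-log p` is at most `m * (-log p)`.
  nlinarith

end QLearn

theorem mainTheorem3 (p : ℝ) (hp₀ : 0 < p) (hp₁ : p < 1) :
    ∃ c : ℝ, 0 < c ∧
      ∀ n d : ℕ, 1 ≤ n → 2 ≤ d →
        ∀ ε : ℝ, 0 < ε → ε < p →
          ∀ (m : ℕ) (A : QLearn.ProductLearner n d m),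
            A.Learns ε p → c * ((n : ℝ) * (d : ℝ) / ε) ≤ (m : ℝ) := by
  obtain ⟨β, hβ, h⟩ := QLearn.exists_dim_le p hp₀ hp₁
  set a : ℝ := p * Real.exp (-(1 / (1 - p))) with ha
  have ha0 : 0 < a := by positivity
  -- The factor `2` pays for `d = D + 1 ≤ 2 D`, and `1 + β` for `m + D ≤ (1 + β) m`.
  refine ⟨a / (2 * (1 + β)), by positivity, fun n d hn hd ε hε hεp m A hA => ?_⟩
  obtain ⟨D, rfl⟩ : ∃ D, d = D + 1 := ⟨d - 1, by omega⟩
  have hn0 : n ≠ 0 := by omega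
  have hD0 : D ≠ 0 := by omega
  have h1 := h n D m A ε hn0 hD0 hε hεp hA
  have h2 := hA.le_add hn0 hD0 hp₁ hε hεp
  have hD1 : (1 : ℝ) ≤ D := Nat.one_le_cast.mpr (Nat.one_le_iff_ne_zero.mpr hD0)
  have h3 : (n : ℝ) * ((D + 1 : ℕ) : ℝ) / ε ≤ 2 * (n * D / ε) := by
    rw [← mul_div_assoc]
    refine div_le_div_of_nonneg_right ?_ hε.le
    push_cast
    nlinarith [Nat.cast_nonneg (α := ℝ) n]
  rw [div_mul_eq_mul_div, div_le_iff₀ (by positivity)]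
  have h4 := mul_le_mul_of_nonneg_left h3 ha0.le
  nlinarith
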